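/- **Corollary A.3 (Consistency).** Let $\mathcal X_1,\dots,\mathcal X_K$ be Polish spaces, $\mathcal Z=\mathcal X_1\times\dots\times\mathcal X_K$, let $\mu^i$ be a Borel probability measure on $\mathcal X_i$, and let $\pi^0\in\Pi(\mu^1,\dots,\mu^K)$, the set of Borel probability measures on $\mathcal Z$ with marginals $\mu^1,\dots,\mu^K$. For Borel measures $\nu^1,\dots,\nu^K$ on $\mathcal X_1,\dots,\mathcal X_K$ and $\rho$ on $\mathcal Z$, a solution of the projection problem with input $(\nu^1,\dots,\nu^K,\rho)$ is a $\pi\in\Pi(\nu^1,\dots,\nu^K)$ that attains $$\min_{\pi\in\Pi(\nu^1,\dots,\nu^K)}\ \min_{\gamma\in\Pi(\pi,\rho)}\int c(\boldsymbol x,\boldsymbol z)\,d\gamma(\boldsymbol x,\boldsymbol z).$$ Assume that $c:\mathcal Z\times\mathcal Z\to\mathbb R$ is continuous and nonnegative, that $c(\boldsymbol x,\boldsymbol x)=0$ for all $\boldsymbol x\in\mathcal Z$, that $c\in L^1\big((\mu^1\otimes\dots\otimes\mu^K)\otimes\pi^0\big)$, and that $\pi^0$ is the only solution of the projection problem with input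 $(\mu^1,\dots,\mu^K,\pi^0)$ (this holds, for example, whenever $c(\boldsymbol x,\boldsymbol z)>0$ for all $\boldsymbol x\ne\boldsymbol z$). Let $\boldsymbol Z_1,\boldsymbol Z_2,\dots$ be i.i.d. with law $\pi^0$ and, for each $i$, let $X_{i1},X_{i2},\dots$ be i.i.d. with law $\mu^i$, all on one probability space. Put $\pi^0_m=\frac1m\sum_{j=1}^m\delta_{\boldsymbol Z_j}$ and $\mu^i_n=\frac1n\sum_{j=1}^n\delta_{X_{ij}}$. Let $m(t),n(t)$ be sequences of positive integers with $m(t),n(t)\to\infty$ as $t\to\infty$. Then almost surely the following holds: whenever $\hat\pi_t$ is, for each $t$, a solution of the projection problem with the empirical input $(\mu^1_{n(t)},\dots,\mu^K_{n(t)},\pi^0_{m(t)})$, there is a subsequence of $(\hat\pi_t)$ that converges weakly to $\pi^0$. -/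

import Mathlib

open MeasureTheory ProbabilityTheory Filter Topology
open scoped ENNReal

noncomputable section

namespace OTProjection

/-- The empirical measure `(1/n) ∑_{j < n} δ_{x j}` of the first `n` points of a sequence. -/
def empiricalMeasure {α : Type*} [MeasurableSpace α] (n : ℕ) (x : ℕ → α) : Measure α :=
  (n : ℝ≥0∞)⁻¹ • ∑ j ∈ Finset.range n, Measure.dirac (x j)

/-- `Π(μ¹, …, μᴷ)`: the probability measures on `X₁ × ⋯ × X_K` with marginals `μ¹, …, μᴷ`. -/
def couplings {K : ℕ} {X : Fin K → Type*} [∀ i, MeasurableSpace (X i)]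
    (μ : ∀ i, Measure (X i)) : Set (ProbabilityMeasure (∀ i, X i)) :=
  {π | ∀ i, (π : Measure (∀ i, X i)).map (fun x => x i) = μ i}

/-- `Π(π, ρ)`: the transport plans (probability measures on the product) from `π` to `ρ`. -/
def plans {E F : Type*} [MeasurableSpace E] [MeasurableSpace F]
    (π : Measure E) (ρ : Measure F) : Set (ProbabilityMeasure (E × F)) :=
  {γ | (γ : Measure (E × F)).map Prod.fst = π ∧ (γ : Measure (E × F)).map Prod.snd = ρ}

/-- The transport cost `∫ c dγ ∈ [0, ∞]` of a plan, for a nonnegative cost function `c`. -/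
def cost {E F : Type*} [MeasurableSpace E] [MeasurableSpace F]
    (c : E → F → ℝ) (γ : ProbabilityMeasure (E × F)) : ℝ≥0∞ :=
  ∫⁻ p, ENNReal.ofReal (c p.1 p.2) ∂(γ : Measure (E × F))

/-- `π` is an optimal transport projection of `ρ` onto `Π(μ)`, that is, a solution of
`min_{π ∈ Π(μ)} min_{γ ∈ Π(π, ρ)} ∫ c dγ`: it is in `Π(μ)`, and some plan from `π` to `ρ`
attains the double minimum. -/
def IsProjection {K : ℕ} {X : Fin K → Type*} [∀ i, MeasurableSpace (X i)]
    (c : (∀ i, X i) → (∀ i, X i) → ℝ) (μ : ∀ i, Measure (X i)) (ρ : Measure (∀ i, X i))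
    (π : ProbabilityMeasure (∀ i, X i)) : Prop :=
  π ∈ couplings μ ∧
    ∃ γ ∈ plans (π : Measure (∀ i, X i)) ρ,
      ∀ π' ∈ couplings μ, ∀ γ' ∈ plans (π' : Measure (∀ i, X i)) ρ, cost c γ ≤ cost c γ'

end OTProjection

end

/-! The double minimum is one multimarginal transport problem: a plan to `ρ` from some `π ∈ Π(ν)` is
a measure on `Z × X₁ × ⋯ × X_K` with marginals `ρ, ν₁, …, ν_K`, and the projections are the
`X`-marginals of its minimizers. Almost surely the empirical marginals converge weakly
(`ae_tendsto_empiricalMeasure`), so the empirical minimizers are tight and subconverge to some `γ`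
with the limiting marginals. Once `γ` is known to be optimal, uniqueness forces its `X`-marginal to
be `π⁰`.

Optimality of `γ` is the crux (`isOptimal_of_tendsto`). The cost may be unbounded and is integrable
only for the product of the limiting marginals, so total costs along the sequence are never passed
to the limit. Instead, optimality is inherited by dominated pieces (`IsOptimal.lintegral_le`). A
measure `α ≪ γ` on a compact box is moved by less than `δ` onto a measure dominated by a multiple of
an approximating minimizer, and a rival `β` is moved along coordinatewise. Optimality compares the
moved measures, and uniform continuity of the cost carries this back to `α` and `β`
(`lintegral_le_of_tendsto_of_isOptimal`).

To reach `γ` itself, restrict it to a large box. `exists_competitor` adapts a rival to the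
restricted marginals by adding small measures below a multiple of the product measure, whose cost
integrability makes negligible. -/

noncomputable section

namespace MultimarginalOT

open scoped NNReal

/-! ### Optimality passes to dominated measures -/

section Marginals

variable {ι : Type*} {W : ι → Type*} [∀ o, MeasurableSpace (W o)]

/-- Two measures on a product space have the same one-dimensional marginals. -/
def SameMarginals (α β : Measure (∀ o, W o)) : Prop :=
  ∀ o, α.map (fun x => x o) = β.map (fun x => x o)

/-- `γ` minimizes the transport cost among all measures with the same marginals. -/
def IsOptimal (c : (∀ o, W o) → ℝ≥0) (γ : Measure (∀ o, W o)) : Prop :=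
  ∀ γ' : Measure (∀ o, W o), SameMarginals γ' γ → ∫⁻ x, c x ∂γ ≤ ∫⁻ x, c x ∂γ'

theorem SameMarginals.measure_univ_eq [Nonempty ι] {α β : Measure (∀ o, W o)}
    (h : SameMarginals α β) : α Set.univ = β Set.univ := by
  obtain ⟨o⟩ := ‹Nonempty ι›
  have := congrArg (fun ν => ν Set.univ) (h o)
  simpa [Measure.map_apply (measurable_pi_apply o) MeasurableSet.univ] using this

/-- Optimality of a measure of finite cost is inherited by the measures that it dominates. -/
theorem IsOptimal.lintegral_le {c : (∀ o, W o) → ℝ≥0} {γ : Measure (∀ o, W o)}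
    [IsFiniteMeasure γ] (hγ : IsOptimal c γ) (hfin : ∫⁻ x, c x ∂γ ≠ ∞)
    {α β : Measure (∀ o, W o)} {M : ℝ≥0} (hM : M ≠ 0) (hα : α ≤ M • γ)
    (hαβ : SameMarginals β α) : ∫⁻ x, c x ∂α ≤ ∫⁻ x, c x ∂β := by
  have : IsFiniteMeasure α := isFiniteMeasure_of_le _ hα
  -- Exchanging `α` for `β` in `M • γ = κ + α` and dividing by `M` gives a competitor of `γ`.
  set κ : Measure (∀ o, W o) := M • γ - α with hκ
  have hsum : κ + α = M • γ := Measure.sub_add_cancel_of_le hα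
  have hsm : SameMarginals (M⁻¹ • (κ + β)) γ := by
    intro o
    have ho : Measurable fun x : ∀ o, W o => x o := measurable_pi_apply o
    have h1 : (κ + β).map (fun x => x o) = (M • γ).map (fun x => x o) := by
      rw [← hsum, Measure.map_add _ _ ho, Measure.map_add _ _ ho, hαβ o]
    rw [Measure.map_smul, h1, Measure.map_smul, smul_smul, inv_mul_cancel₀ hM, one_smul]
  have h := hγ _ hsm
  have h2 : (M : ℝ≥0∞) * ∫⁻ x, c x ∂γ ≤ ∫⁻ x, c x ∂(κ + β) := by
    have h3 := mul_le_mul_right h (M : ℝ≥0∞)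
    rwa [lintegral_smul_measure, ENNReal.smul_def, smul_eq_mul, ← mul_assoc, ← ENNReal.coe_mul,
      mul_inv_cancel₀ hM, ENNReal.coe_one, one_mul] at h3
  have h4 : (M : ℝ≥0∞) * ∫⁻ x, c x ∂γ = ∫⁻ x, c x ∂(κ + α) := by
    rw [hsum, lintegral_smul_measure, ENNReal.smul_def, smul_eq_mul]
  rw [h4, lintegral_add_measure, lintegral_add_measure] at h2
  refine (ENNReal.add_le_add_iff_left ?_).1 h2
  -- Cancelling the common part `κ` needs its cost to be finite.
  have h5 : (∫⁻ x, c x ∂κ) + ∫⁻ x, c x ∂α ≠ ∞ := by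
    rw [← lintegral_add_measure, ← h4]
    exact ENNReal.mul_ne_top ENNReal.coe_ne_top hfin
  exact (ENNReal.add_ne_top.1 h5).1

end Marginals

/-! ### Coordinatewise transfer of couplings -/

section Coupling

variable {ι : Type*} [Fintype ι] {W : ι → Type*} [∀ o, MeasurableSpace (W o)]

/-- The kernel that moves the coordinates of a point independently. -/
def piKernel (ν : ∀ o, Kernel (W o) (W o)) [∀ o, IsMarkovKernel (ν o)] :
    Kernel (∀ o, W o) (∀ o, W o) where
  toFun x := Measure.pi fun o => ν o (x o)
  measurable' := by
    refine Measurable.measure_of_isPiSystem_of_isProbabilityMeasure generateFrom_pi.symm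
      isPiSystem_pi ?_
    rintro _ ⟨s, hs, rfl⟩
    simp_rw [Measure.pi_pi]
    exact Finset.measurable_prod _ fun o _ =>
      ((ν o).measurable_coe (hs o (Set.mem_univ o))).comp (measurable_pi_apply o)

theorem piKernel_apply (ν : ∀ o, Kernel (W o) (W o)) [∀ o, IsMarkovKernel (ν o)]
    (x : ∀ o, W o) : piKernel ν x = Measure.pi fun o => ν o (x o) := rfl

instance (ν : ∀ o, Kernel (W o) (W o)) [∀ o, IsMarkovKernel (ν o)] :
    IsMarkovKernel (piKernel ν) :=
  ⟨fun x => by rw [piKernel_apply]; infer_instance⟩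

/-- A coupling with first marginal `α` can be transferred to every `β` that has the same
one-dimensional marginals as `α`, keeping the joint laws of corresponding coordinates. -/
theorem exists_coupling_transfer [∀ o, StandardBorelSpace (W o)] [∀ o, Nonempty (W o)]
    {α β : Measure (∀ o, W o)} [IsFiniteMeasure β] (hαβ : SameMarginals β α)
    (θ : Measure ((∀ o, W o) × (∀ o, W o))) [IsFiniteMeasure θ] (hθ : θ.fst = α) :
    ∃ Θ : Measure ((∀ o, W o) × (∀ o, W o)), Θ.fst = β ∧
      ∀ o, Θ.map (fun q => (q.1 o, q.2 o)) = θ.map (fun q => (q.1 o, q.2 o)) := by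
  have hmeas : ∀ o, Measurable fun q : (∀ o, W o) × (∀ o, W o) => (q.1 o, q.2 o) := fun o => by
    fun_prop
  -- Each coordinate is moved by its own conditional law under `θ`, independently of the others;
  -- only the pair laws have to survive.
  set ν : ∀ o, Kernel (W o) (W o) :=
    fun o => (θ.map (fun q => (q.1 o, q.2 o))).condKernel with hν
  have hfst : ∀ o, (θ.map (fun q => (q.1 o, q.2 o))).fst = β.map (fun x => x o) := by
    intro o
    rw [hαβ o, ← hθ, Measure.fst, Measure.fst, Measure.map_map measurable_fst (hmeas o),
      Measure.map_map (measurable_pi_apply o) measurable_fst]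
    rfl
  refine ⟨β ⊗ₘ piKernel ν, Measure.fst_compProd _ _, fun o => ?_⟩
  rw [← (θ.map (fun q => (q.1 o, q.2 o))).disintegrate
    (θ.map (fun q => (q.1 o, q.2 o))).condKernel, hfst o]
  ext s hs
  rw [Measure.map_apply (hmeas o) hs, Measure.compProd_apply (hmeas o hs),
    Measure.compProd_apply hs, lintegral_map (Kernel.measurable_kernel_prodMk_left hs)
      (measurable_pi_apply o)]
  refine lintegral_congr fun x => ?_
  have := (measurePreserving_eval (fun o => ν o (x o)) o).measure_preimage
    (measurable_prodMk_left (x := x o) hs).nullMeasurableSet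
  rw [piKernel_apply, ← this]
  rfl

/-- Two measures that are coupled within a region where the cost varies by at most `η`
have nearly the same cost. -/
theorem lintegral_fst_le_of_ae {G : Type*} [MeasurableSpace G] {c : G → ℝ≥0} (hc : Measurable c)
    {θ : Measure (G × G)} {η : ℝ≥0} (h : ∀ᵐ q ∂θ, c q.1 ≤ c q.2 + η) :
    ∫⁻ x, c x ∂θ.fst ≤ ∫⁻ x, c x ∂θ.snd + η * θ Set.univ := by
  have hc' : Measurable fun x => (c x : ℝ≥0∞) := hc.coe_nnreal_ennreal
  rw [Measure.fst, Measure.snd, lintegral_map hc' measurable_fst,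
    lintegral_map hc' measurable_snd, ← lintegral_const,
    ← lintegral_add_left (f := fun q : G × G => (c q.2 : ℝ≥0∞)) (hc'.comp measurable_snd)]
  refine lintegral_mono_ae (h.mono fun q hq => ?_)
  exact_mod_cast hq

theorem lintegral_snd_le_of_ae {G : Type*} [MeasurableSpace G] {c : G → ℝ≥0} (hc : Measurable c)
    {θ : Measure (G × G)} {η : ℝ≥0} (h : ∀ᵐ q ∂θ, c q.2 ≤ c q.1 + η) :
    ∫⁻ x, c x ∂θ.snd ≤ ∫⁻ x, c x ∂θ.fst + η * θ Set.univ := by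
  have hc' : Measurable fun x => (c x : ℝ≥0∞) := hc.coe_nnreal_ennreal
  rw [Measure.fst, Measure.snd, lintegral_map hc' measurable_fst,
    lintegral_map hc' measurable_snd, ← lintegral_const,
    ← lintegral_add_left (f := fun q : G × G => (c q.1 : ℝ≥0∞)) (hc'.comp measurable_fst)]
  refine lintegral_mono_ae (h.mono fun q hq => ?_)
  exact_mod_cast hq

end Coupling

/-! ### Couplings within small distance -/

section LocalCoupling

variable {G : Type*} [PseudoMetricSpace G]

/-- If balls of radius `δ` around `α`-almost every point carry `γ`-mass at least `m`, then `α`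
can be coupled, within distance `δ`, with a measure dominated by a multiple of `γ`. -/
theorem exists_local_coupling [SecondCountableTopology G] [MeasurableSpace G] [BorelSpace G]
    (α γ : Measure G) [IsFiniteMeasure α] [IsFiniteMeasure γ]
    {δ : ℝ} {m : ℝ≥0} (hm : m ≠ 0) (h : ∀ᵐ p ∂α, (m : ℝ≥0∞) ≤ γ (Metric.ball p δ)) :
    ∃ θ : Measure (G × G), θ.fst = α ∧ (∀ᵐ q ∂θ, dist q.2 q.1 < δ) ∧
      ∃ M : ℝ≥0, M ≠ 0 ∧ θ.snd ≤ M • γ := by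
  set D : Set (G × G) := {q | dist q.2 q.1 < δ} with hD
  have hDm : MeasurableSet D :=
    measurableSet_lt (measurable_snd.dist measurable_fst) measurable_const
  have hball : ∀ p, Prod.mk p ⁻¹' D = Metric.ball p δ := fun p => rfl
  have hbm : Measurable fun p => γ (Metric.ball p δ) := by
    simpa only [hball] using measurable_measure_prodMk_left (ν := γ) hDm
  -- Each `p` is sent to `γ` normalized on the `δ`-ball around `p`.
  set f : G × G → ℝ≥0∞ := D.indicator fun q => (γ (Metric.ball q.1 δ))⁻¹ with hf
  have hfm : Measurable f := ((hbm.comp measurable_fst).inv).indicator hDm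
  have hfle : ∀ᵐ p ∂α, ∀ p', f (p, p') ≤ (m : ℝ≥0∞)⁻¹ := by
    filter_upwards [h] with p hp p'
    rw [hf]
    refine (Set.indicator_le_self' (fun _ _ => zero_le) _).trans ?_
    exact ENNReal.inv_le_inv.2 hp
  have hfint : ∀ᵐ p ∂α, ∫⁻ p', f (p, p') ∂γ = 1 := by
    filter_upwards [h] with p hp
    have : (fun p' => f (p, p'))
        = (Metric.ball p δ).indicator fun _ => (γ (Metric.ball p δ))⁻¹ := rfl
    rw [this, lintegral_indicator_const measurableSet_ball]
    refine ENNReal.inv_mul_cancel ?_ (measure_ne_top _ _)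
    exact (lt_of_lt_of_le (by exact_mod_cast pos_iff_ne_zero.2 hm) hp).ne'
  -- The extra `m⁻¹` only keeps the constant nonzero when `α = 0`.
  refine ⟨(α.prod γ).withDensity f, ?_, ?_, (m⁻¹ * (α Set.univ).toNNReal) + m⁻¹, ?_, ?_⟩
  · ext s hs
    rw [Measure.fst_apply hs, withDensity_apply _ (measurable_fst hs),
      ← Set.prod_univ, setLIntegral_prod _ hfm.aemeasurable]
    simp only [Measure.restrict_univ]
    rw [lintegral_congr_ae (ae_restrict_of_ae hfint)]
    simp
  · rw [ae_withDensity_iff hfm]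
    refine Eventually.of_forall fun q hq => ?_
    by_contra hcon
    exact hq (Set.indicator_of_notMem (show q ∉ D from hcon) _)
  · simp [hm]
  · refine Measure.le_intro fun s hs _ => ?_
    rw [Measure.snd_apply hs, withDensity_apply _ (measurable_snd hs),
      ← Set.univ_prod, setLIntegral_prod _ hfm.aemeasurable]
    simp only [Measure.restrict_univ]
    calc ∫⁻ p, ∫⁻ p' in s, f (p, p') ∂γ ∂α
        ≤ ∫⁻ _, (m : ℝ≥0∞)⁻¹ * γ s ∂α := by
          refine lintegral_mono_ae (hfle.mono fun p hp => ?_)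
          calc ∫⁻ p' in s, f (p, p') ∂γ ≤ ∫⁻ _ in s, (m : ℝ≥0∞)⁻¹ ∂γ := lintegral_mono hp
            _ = _ := by simp
      _ = (m : ℝ≥0∞)⁻¹ * α Set.univ * γ s := by
          rw [lintegral_const]; ring
      _ ≤ ((m⁻¹ * (α Set.univ).toNNReal + m⁻¹ : ℝ≥0) : ℝ≥0∞) * γ s := by
          gcongr
          rw [ENNReal.coe_add, ENNReal.coe_mul, ENNReal.coe_toNNReal (measure_ne_top _ _),
            ENNReal.coe_inv hm]
          exact le_self_add
      _ = _ := by simp [Measure.smul_apply, ENNReal.smul_def]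

/-- Along a weakly convergent sequence, the balls around the points of a compact subset of the
support of the limit eventually have mass bounded below. -/
theorem eventually_exists_le_measure_ball [MeasurableSpace G] [BorelSpace G]
    {τ : Type*} {L : Filter τ}
    {γs : τ → ProbabilityMeasure G} {γ : ProbabilityMeasure G} (hγ : Tendsto γs L (𝓝 γ))
    {S : Set G} (hS : IsCompact S) (hSγ : S ⊆ (γ : Measure G).support) {δ : ℝ} (hδ : 0 < δ) :
    ∀ᶠ t in L, ∃ m : ℝ≥0, m ≠ 0 ∧
      ∀ p ∈ S, (m : ℝ≥0∞) ≤ (γs t : Measure G) (Metric.ball p δ) := by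
  obtain ⟨F, hFS, hF⟩ := hS.elim_nhds_subcover (fun p => Metric.ball p (δ / 2))
    fun p _ => Metric.ball_mem_nhds p (half_pos hδ)
  have hpos : ∀ a ∈ F, ∀ᶠ t in L, 0 < (γs t : Measure G) (Metric.ball a (δ / 2)) := by
    intro a ha
    have h0 := (Measure.mem_support_iff_forall a).1 (hSγ (hFS a ha)) _
      (Metric.ball_mem_nhds a (half_pos hδ))
    have h1 := ProbabilityMeasure.le_liminf_measure_open_of_tendsto hγ
      (Metric.isOpen_ball (x := a) (ε := δ / 2))
    exact eventually_lt_of_lt_liminf (h0.trans_le h1)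
  filter_upwards [(eventually_all_finset F).2 hpos] with t ht
  have hinf : 0 < F.inf fun a => (γs t : Measure G) (Metric.ball a (δ / 2)) :=
    (Finset.lt_inf_iff ENNReal.zero_lt_top).2 ht
  obtain ⟨m, hm0, hm⟩ := ENNReal.lt_iff_exists_nnreal_btwn.1 hinf
  refine ⟨m, (by exact_mod_cast hm0.ne'), fun p hp => ?_⟩
  obtain ⟨a, ha, hpa⟩ := Set.mem_iUnion₂.1 (hF hp)
  refine hm.le.trans ((Finset.inf_le ha).trans (measure_mono fun y hy => ?_))
  rw [Metric.mem_ball] at hpa hy ⊢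
  calc dist y p ≤ dist y a + dist p a := dist_triangle_right _ _ _
    _ < δ := by linarith

/-- A continuous function is uniformly continuous near a compact set. -/
theorem exists_forall_le_add_of_isCompact {c : G → ℝ≥0} (hc : Continuous c) {S : Set G}
    (hS : IsCompact S) {η : ℝ≥0} (hη : 0 < η) :
    ∃ δ > 0, ∀ p ∈ S, ∀ q, dist q p < δ → c p ≤ c q + η ∧ c q ≤ c p + η := by
  have h := hS.uniformContinuousAt_of_continuousAt c (fun a _ => hc.continuousAt)
    (Metric.dist_mem_uniformity (show (0 : ℝ) < η from hη))
  obtain ⟨δ, hδ, hsub⟩ := Metric.mem_uniformity_dist.1 h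
  refine ⟨δ, hδ, fun p hp q hq => ?_⟩
  have h1 : dist (c p) (c q) < η := hsub (by rwa [dist_comm]) hp
  rw [NNReal.dist_eq, abs_lt] at h1
  constructor <;> rw [← NNReal.coe_le_coe, NNReal.coe_add] <;> linarith

end LocalCoupling

/-! ### Limits of minimizers on compact boxes -/

section Transfer

variable {ι : Type*} [Fintype ι] [Nonempty ι] {W : ι → Type*} [∀ o, MetricSpace (W o)]
  [∀ o, CompleteSpace (W o)] [∀ o, SecondCountableTopology (W o)]
  [∀ o, MeasurableSpace (W o)] [∀ o, BorelSpace (W o)]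

/-- A weak limit of optimal measures of finite cost cannot be improved on compact boxes. -/
theorem lintegral_le_of_tendsto_of_isOptimal {c : (∀ o, W o) → ℝ≥0} (hc : Continuous c)
    {τ : Type*} {L : Filter τ} [L.NeBot] {γs : τ → ProbabilityMeasure (∀ o, W o)}
    {γ : ProbabilityMeasure (∀ o, W o)} (hγ : Tendsto γs L (𝓝 γ))
    (hopt : ∀ t, IsOptimal c (γs t : Measure (∀ o, W o)))
    (hfin : ∀ t, ∫⁻ x, c x ∂(γs t : Measure (∀ o, W o)) ≠ ∞)
    {C : ∀ o, Set (W o)} (hC : ∀ o, IsCompact (C o)) {α β : Measure (∀ o, W o)}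
    [IsFiniteMeasure α] (hαβ : SameMarginals β α)
    (hαγ : α ≪ (γ : Measure (∀ o, W o))) (hαC : ∀ᵐ x ∂α, ∀ o, x o ∈ C o) :
    ∫⁻ x, c x ∂α ≤ ∫⁻ x, c x ∂β := by
  have hW : ∀ o, Nonempty (W o) := by
    have : Nonempty (∀ o, W o) := (γ : Measure (∀ o, W o)).nonempty_of_neZero
    exact Classical.nonempty_pi.1 this
  have : IsFiniteMeasure β := ⟨by rw [hαβ.measure_univ_eq]; exact measure_lt_top _ _⟩
  have hB : IsCompact (Set.univ.pi C) := isCompact_univ_pi hC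
  -- Being carried by a box depends on the marginals alone.
  have hβC : ∀ᵐ x ∂β, ∀ o, x o ∈ C o := by
    refine ae_all_iff.2 fun o => ?_
    have h1 : ∀ᵐ y ∂(α.map fun x => x o), y ∈ C o :=
      (ae_map_iff (measurable_pi_apply o).aemeasurable (hC o).measurableSet).2
        (hαC.mono fun x hx => hx o)
    rw [← hαβ o] at h1
    exact (ae_map_iff (measurable_pi_apply o).aemeasurable (hC o).measurableSet).1 h1
  have key : ∀ η : ℝ≥0, 0 < η →
      ∫⁻ x, c x ∂α ≤ ∫⁻ x, c x ∂β + η * (2 * α Set.univ) := by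
    intro η hη
    obtain ⟨δ, hδ, hcδ⟩ := exists_forall_le_add_of_isCompact hc hB hη
    set S := Set.univ.pi C ∩ (γ : Measure (∀ o, W o)).support with hS
    have hSc : IsCompact S := hB.inter_right Measure.isClosed_support
    -- A single index `t` suffices for each `η`, so `m` and `M` need no uniformity in `t`.
    obtain ⟨t, m, hm, hmt⟩ :=
      (eventually_exists_le_measure_ball hγ hSc Set.inter_subset_right hδ).exists
    have hball : ∀ᵐ p ∂α, (m : ℝ≥0∞) ≤ (γs t : Measure (∀ o, W o)) (Metric.ball p δ) := by
      filter_upwards [hαC, hαγ Measure.support_mem_ae] with p hp hp'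
      exact hmt p ⟨fun o _ => hp o, hp'⟩
    obtain ⟨θ, hθα, hθδ, M, hM, hθM⟩ :=
      exists_local_coupling α (γs t : Measure (∀ o, W o)) hm hball
    have hθuniv : θ Set.univ = α Set.univ := by rw [← hθα, Measure.fst_univ]
    have : IsFiniteMeasure θ := ⟨by rw [hθuniv]; exact measure_lt_top _ _⟩
    obtain ⟨Θ, hΘβ, hΘ⟩ := exists_coupling_transfer hαβ θ hθα
    have hΘuniv : Θ Set.univ = α Set.univ := by
      rw [← hαβ.measure_univ_eq, ← hΘβ, Measure.fst_univ]
    have hmeas : ∀ o, Measurable fun q : (∀ o, W o) × (∀ o, W o) => (q.1 o, q.2 o) :=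
      fun o => by fun_prop
    -- In the sup metric, closeness is a condition on the pair laws, which `Θ` shares with `θ`.
    have hΘδ : ∀ᵐ q ∂Θ, dist q.2 q.1 < δ := by
      have h1 : ∀ o, ∀ᵐ q ∂Θ, dist (q.2 o) (q.1 o) < δ := by
        intro o
        have hms : MeasurableSet {z : W o × W o | dist z.2 z.1 < δ} :=
          measurableSet_lt (measurable_snd.dist measurable_fst) measurable_const
        have h2 : ∀ᵐ z ∂(θ.map fun q => (q.1 o, q.2 o)), dist z.2 z.1 < δ := by
          refine (ae_map_iff (hmeas o).aemeasurable hms).2 (hθδ.mono fun q hq => ?_)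
          exact (dist_le_pi_dist _ _ o).trans_lt hq
        rw [← hΘ o] at h2
        exact (ae_map_iff (hmeas o).aemeasurable hms).1 h2
      exact (ae_all_iff.2 h1).mono fun q hq => (dist_pi_lt_iff hδ).2 hq
    have hsm : SameMarginals Θ.snd θ.snd := by
      intro o
      have h1 := congrArg (fun ν => ν.snd) (hΘ o)
      simp only [Measure.snd] at h1 ⊢
      rw [Measure.map_map measurable_snd (hmeas o),
        Measure.map_map measurable_snd (hmeas o)] at h1
      rw [Measure.map_map (measurable_pi_apply o) measurable_snd,
        Measure.map_map (measurable_pi_apply o) measurable_snd]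
      exact h1
    have hmemθ : ∀ᵐ q ∂θ, q.1 ∈ Set.univ.pi C := by
      rw [← hθα, Measure.fst] at hαC
      exact (ae_of_ae_map measurable_fst.aemeasurable hαC).mono fun q hq o _ => hq o
    have hmemΘ : ∀ᵐ q ∂Θ, q.1 ∈ Set.univ.pi C := by
      rw [← hΘβ, Measure.fst] at hβC
      exact (ae_of_ae_map measurable_fst.aemeasurable hβC).mono fun q hq o _ => hq o
    have e1 : ∫⁻ x, c x ∂θ.fst ≤ ∫⁻ x, c x ∂θ.snd + η * θ Set.univ :=
      lintegral_fst_le_of_ae hc.measurable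
        ((hmemθ.and hθδ).mono fun q hq => (hcδ _ hq.1 _ hq.2).1)
    have e2 : ∫⁻ x, c x ∂Θ.snd ≤ ∫⁻ x, c x ∂Θ.fst + η * Θ Set.univ :=
      lintegral_snd_le_of_ae hc.measurable
        ((hmemΘ.and hΘδ).mono fun q hq => (hcδ _ hq.1 _ hq.2).2)
    have e3 : ∫⁻ x, c x ∂θ.snd ≤ ∫⁻ x, c x ∂Θ.snd :=
      (hopt t).lintegral_le (hfin t) hM hθM hsm
    rw [hθα, hθuniv] at e1
    rw [hΘβ, hΘuniv] at e2
    calc ∫⁻ x, c x ∂α ≤ (∫⁻ x, c x ∂β + η * α Set.univ) + η * α Set.univ :=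
          e1.trans (add_le_add_left (e3.trans e2) _)
      _ = _ := by ring
  refine ENNReal.le_of_forall_pos_le_add fun ε hε _ => ?_
  set a : ℝ≥0 := 2 * (α Set.univ).toNNReal + 1 with ha
  have ha0 : a ≠ 0 := by positivity
  refine (key (ε / a) (by positivity)).trans (add_le_add_right ?_ _)
  calc ((ε / a : ℝ≥0) : ℝ≥0∞) * (2 * α Set.univ) ≤ ((ε / a : ℝ≥0) : ℝ≥0∞) * (a : ℝ≥0∞) := by
        gcongr
        rw [ha, ENNReal.coe_add, ENNReal.coe_mul, ENNReal.coe_toNNReal (measure_ne_top _ _)]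
        exact le_self_add
    _ = ε := by rw [← ENNReal.coe_mul, div_mul_cancel₀ _ ha0]

end Transfer

/-! ### Comparison of product measures -/

section ProductMeasures

variable {ι : Type*} [Fintype ι] {W : ι → Type*} [∀ o, MeasurableSpace (W o)]

/-- The bound on boxes suffices because `OuterMeasure.pi` is the largest outer measure obeying it.
-/
theorem pi_mono_measure {μ ν : ∀ o, Measure (W o)} [∀ o, SigmaFinite (μ o)]
    [∀ o, SigmaFinite (ν o)] (h : ∀ o, ν o ≤ μ o) : Measure.pi ν ≤ Measure.pi μ := by
  have h1 : (Measure.pi ν).toOuterMeasure ≤ OuterMeasure.pi fun o => (μ o).toOuterMeasure := by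
    refine OuterMeasure.le_pi.2 fun s _ => ?_
    change Measure.pi ν (Set.univ.pi s) ≤ _
    rw [Measure.pi_pi]
    exact Finset.prod_le_prod' fun o _ => h o (s o)
  refine Measure.le_intro fun s hs _ => ?_
  rw [Measure.pi_def μ, toMeasure_apply _ _ hs]
  exact h1 s

theorem pi_smul_measure (μ : ∀ o, Measure (W o)) [∀ o, SigmaFinite (μ o)] (r : ℝ≥0) :
    Measure.pi (fun o => r • μ o) = r ^ Fintype.card ι • Measure.pi μ := by
  refine Measure.pi_eq fun s _ => ?_
  simp only [Measure.smul_apply, ENNReal.smul_def, smul_eq_mul, Measure.pi_pi, ENNReal.coe_pow,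
    Finset.prod_mul_distrib, Finset.prod_const, Finset.card_univ]

end ProductMeasures

/-! ### Densities and small mass -/

section Density

/-- Truncating the Radon–Nikodym derivative at `1` makes the bound hold everywhere, not just almost
everywhere. -/
theorem exists_density_of_le {Y : Type*} [MeasurableSpace Y] {α μ : Measure Y}
    [IsFiniteMeasure μ] (h : α ≤ μ) :
    ∃ f : Y → ℝ≥0∞, Measurable f ∧ (∀ y, f y ≤ 1) ∧ μ.withDensity f = α := by
  have : IsFiniteMeasure α := isFiniteMeasure_of_le μ h
  refine ⟨fun y => min (α.rnDeriv μ y) 1, (Measure.measurable_rnDeriv α μ).min measurable_const,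
    fun y => min_le_right _ _, ?_⟩
  have h1 : (fun y => min (α.rnDeriv μ y) 1) =ᵐ[μ] α.rnDeriv μ := by
    filter_upwards [Measure.rnDeriv_le_one_of_le h] with y hy
    exact min_eq_left hy
  rw [withDensity_congr_ae h1, Measure.withDensity_rnDeriv_eq _ _
    (Measure.absolutelyContinuous_of_le h)]

/-- A union bound, which controls the mass lost on multiplying by a product of densities. -/
theorem one_le_prod_add_sum {ι : Type*} (s : Finset ι) (h : ι → ℝ≥0∞) (hle : ∀ o, h o ≤ 1) :
    1 ≤ ∏ o ∈ s, h o + ∑ o ∈ s, (1 - h o) := by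
  classical
  induction s using Finset.induction_on with
  | empty => simp
  | insert a s ha ih =>
    rw [Finset.prod_insert ha, Finset.sum_insert ha]
    have hp : ∏ o ∈ s, h o ≤ 1 := Finset.prod_le_one' fun o _ => hle o
    calc 1 ≤ ∏ o ∈ s, h o + ∑ o ∈ s, (1 - h o) := ih
      _ = (h a + (1 - h a)) * ∏ o ∈ s, h o + ∑ o ∈ s, (1 - h o) := by
        rw [add_tsub_cancel_of_le (hle a), one_mul]
      _ ≤ h a * ∏ o ∈ s, h o + (1 - h a) + ∑ o ∈ s, (1 - h o) := by
        rw [add_mul]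
        gcongr
        exact mul_le_of_le_one_right' hp
      _ = _ := by ring

/-- The cost of a measure of small mass dominated by a fixed measure is small. -/
theorem exists_forall_lintegral_le {G : Type*} [MeasurableSpace G] {c : G → ℝ≥0}
    (hc : Measurable c) {m : Measure G} (hm : ∫⁻ x, c x ∂m ≠ ∞) {ε : ℝ≥0∞} (hε : ε ≠ 0) :
    ∃ δ : ℝ≥0∞, δ ≠ 0 ∧
      ∀ κ : Measure G, κ ≤ m → κ Set.univ ≤ δ → ∫⁻ x, c x ∂κ ≤ ε := by
  have hcm : Measurable fun x => (c x : ℝ≥0∞) := hc.coe_nnreal_ennreal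
  have hε2 : ε / 2 ≠ 0 := (ENNReal.half_pos hε).ne'
  obtain ⟨δ₀, hδ₀, h⟩ := exists_pos_setLIntegral_lt_of_measure_lt hm hε2
  -- Markov's inequality gives the level `R`: above it absolute continuity of the integral applies,
  -- below it the cost is at most `R` times the mass.
  obtain ⟨R, hR0, hR⟩ : ∃ R : ℝ≥0, R ≠ 0 ∧ m {x | (R : ℝ≥0∞) ≤ c x} < δ₀ := by
    obtain ⟨b, hb0, hb⟩ := exists_between hδ₀
    have hbt : b ≠ ∞ := (hb.trans_le le_top).ne
    have hq : (∫⁻ x, c x ∂m) / b ≠ ∞ := ENNReal.div_ne_top hm (ne_of_gt hb0)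
    refine ⟨((∫⁻ x, c x ∂m) / b).toNNReal + 1, by positivity, ?_⟩
    set R : ℝ≥0 := ((∫⁻ x, c x ∂m) / b).toNNReal + 1 with hRdef
    have hR0 : (R : ℝ≥0∞) ≠ 0 := by simp [hRdef]
    refine lt_of_le_of_lt (meas_ge_le_lintegral_div hcm.aemeasurable hR0 ENNReal.coe_ne_top) ?_
    refine lt_of_le_of_lt ?_ hb
    refine ENNReal.div_le_of_le_mul ?_
    rw [mul_comm, ← ENNReal.div_le_iff (ne_of_gt hb0) hbt, hRdef, ENNReal.coe_add,
      ENNReal.coe_toNNReal hq]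
    exact le_self_add
  refine ⟨ε / 2 / R, (ENNReal.div_pos hε2 ENNReal.coe_ne_top).ne', fun κ hκ hκu => ?_⟩
  have hs : MeasurableSet {x | (R : ℝ≥0∞) ≤ c x} := measurableSet_le measurable_const hcm
  rw [← lintegral_add_compl _ hs, ← ENNReal.add_halves ε]
  refine add_le_add ?_ ?_
  · exact (lintegral_mono' (Measure.restrict_mono le_rfl hκ) le_rfl).trans (h _ hR).le
  · calc ∫⁻ x in {x | (R : ℝ≥0∞) ≤ c x}ᶜ, c x ∂κ
        ≤ ∫⁻ x in {x | (R : ℝ≥0∞) ≤ c x}ᶜ, R ∂κ :=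
          setLIntegral_mono measurable_const fun x hx =>
            (not_le.1 (show ¬(R : ℝ≥0∞) ≤ c x from hx)).le
      _ ≤ R * (ε / 2 / R) := by
          rw [lintegral_const, Measure.restrict_apply_univ]
          gcongr
          exact (measure_mono (Set.subset_univ _)).trans hκu
      _ ≤ ε / 2 := ENNReal.mul_div_le

end Density

/-! ### Repairing the marginals of a rival -/

section Competitor

variable {ι : Type*} [Fintype ι] {W : ι → Type*} [∀ o, MeasurableSpace (W o)]

/-- If `γ` and `ν` have the same marginals `μ`, then the restriction of `γ` to a set of nearly
full measure has, up to a scalar, the marginals of a measure that differs from one dominated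
by `ν` by small measures dominated by a multiple of `⊗ μ`. -/
theorem exists_competitor (μ : ∀ o, Measure (W o)) [∀ o, IsProbabilityMeasure (μ o)]
    (γ ν : Measure (∀ o, W o)) [IsProbabilityMeasure γ] [IsProbabilityMeasure ν]
    (hγ : ∀ o, γ.map (fun x => x o) = μ o) (hν : ∀ o, ν.map (fun x => x o) = μ o)
    {C : Set (∀ o, W o)} (hC : MeasurableSet C) (hγC : 2⁻¹ ≤ γ C) :
    ∃ (r : ℝ≥0∞) (ν' : Measure (∀ o, W o)) (κ : ι → Measure (∀ o, W o)),
      1 ≤ r ∧ r ≠ ∞ ∧ ν' ≤ ν ∧ SameMarginals (ν' + ∑ o, κ o) (r • γ.restrict C) ∧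
      ∀ o, κ o ≤ (2 : ℝ≥0) ^ Fintype.card ι • Measure.pi μ ∧
        κ o Set.univ ≤ Fintype.card ι * γ Cᶜ := by
  classical
  have hev : ∀ o, Measurable fun x : ∀ o, W o => x o := fun o => measurable_pi_apply o
  set α := γ.restrict C with hα
  set a := γ C with ha
  have ha0 : a ≠ 0 := fun h => by simp [h] at hγC
  have ha1 : a ≤ 1 := prob_le_one
  have hat : a ≠ ∞ := measure_ne_top _ _
  set A : ∀ o, Measure (W o) := fun o => α.map fun x => x o with hA
  have hAμ : ∀ o, A o ≤ μ o := fun o => by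
    rw [← hγ o]
    exact Measure.map_mono Measure.restrict_le_self (hev o)
  have hAu : ∀ o, A o Set.univ = a := fun o => by
    rw [hA]; simp [Measure.map_apply (hev o) MeasurableSet.univ, hα, ha]
  have : ∀ o, IsFiniteMeasure (A o) := fun o => isFiniteMeasure_of_le _ (hAμ o)
  choose h hm h1 hd using fun o => exists_density_of_le (hAμ o)
  -- Since `g` is below every factor, each marginal of `g ν` is below the target `A o`.
  set g : (∀ o, W o) → ℝ≥0∞ := fun x => ∏ o, h o (x o) with hg
  have hgm : Measurable g := Finset.measurable_prod _ fun o _ => (hm o).comp (hev o)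
  have hgle : ∀ x o, g x ≤ h o (x o) := fun x o => by
    rw [hg]
    simp only
    rw [← Finset.mul_prod_erase _ _ (Finset.mem_univ o)]
    exact mul_le_of_le_one_right' (Finset.prod_le_one' fun i _ => h1 i _)
  have hg1 : ∀ x, g x ≤ 1 := fun x => Finset.prod_le_one' fun i _ => h1 i _
  set ν' := ν.withDensity g with hν'
  have hν'ν : ν' ≤ ν := by
    conv_rhs => rw [← withDensity_one (μ := ν)]
    exact withDensity_mono (Eventually.of_forall hg1)
  have : IsFiniteMeasure ν' := isFiniteMeasure_of_le _ hν'ν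
  have hν'A : ∀ o, ν'.map (fun x => x o) ≤ A o := fun o => by
    refine Measure.le_intro fun s hs _ => ?_
    rw [Measure.map_apply (hev o) hs, ← hd o, withDensity_apply _ (hev o hs),
      withDensity_apply _ hs, ← hν o, setLIntegral_map hs (hm o) (hev o)]
    exact lintegral_mono fun x => hgle x o
  set d : ∀ o, Measure (W o) := fun o => A o - ν'.map (fun x => x o) with hdd
  have hdA : ∀ o, ν'.map (fun x => x o) + d o = A o := fun o => by
    rw [add_comm]; exact Measure.sub_add_cancel_of_le (hν'A o)
  have hdle : ∀ o, d o ≤ μ o := fun o => Measure.sub_le.trans (hAμ o)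
  have : ∀ o, IsFiniteMeasure (d o) := fun o => isFiniteMeasure_of_le _ (hdle o)
  -- All deficits `d o` have this same mass.
  set t := a - ν' Set.univ with ht
  have hdu : ∀ o, d o Set.univ = t := fun o => by
    rw [hdd]
    simp only
    rw [Measure.sub_apply MeasurableSet.univ (hν'A o), hAu,
      Measure.map_apply (hev o) MeasurableSet.univ, Set.preimage_univ]
  have htle : t ≤ Fintype.card ι * γ Cᶜ := by
    have e1 : ∀ o, ∫⁻ x, (1 - h o (x o)) ∂ν = γ Cᶜ := fun o => by
      have e0 : ∫⁻ y, h o y ∂(μ o) = a := by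
        rw [← hAu o, ← hd o, withDensity_apply _ MeasurableSet.univ, Measure.restrict_univ]
      rw [← lintegral_map (f := fun y => 1 - h o y) (measurable_const.sub (hm o)) (hev o), hν o,
        lintegral_sub (hm o) (by rw [e0]; exact hat) (Eventually.of_forall (h1 o)), e0,
        prob_compl_eq_one_sub hC]
      simp [ha]
    have e2 : 1 ≤ ν' Set.univ + Fintype.card ι * γ Cᶜ := by
      calc (1 : ℝ≥0∞) = ∫⁻ _, 1 ∂ν := by simp
        _ ≤ ∫⁻ x, (g x + ∑ o, (1 - h o (x o))) ∂ν :=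
          lintegral_mono fun x => one_le_prod_add_sum _ _ fun o => h1 o _
        _ = _ := by
          have e3 : ∫⁻ x, ∑ o, (1 - h o (x o)) ∂ν = ∑ o, ∫⁻ x, (1 - h o (x o)) ∂ν :=
            lintegral_finsetSum _ fun o _ =>
              (show Measurable fun y => 1 - h o y from measurable_const.sub (hm o)).comp (hev o)
          rw [lintegral_add_left hgm, e3]
          simp [e1, hν', withDensity_apply]
    rw [ht]
    exact tsub_le_iff_left.2 (ha1.trans e2)
  have htt : t ≠ ∞ := ne_top_of_le_ne_top hat tsub_le_self
  set B : ∀ o, Measure (W o) := fun o => a⁻¹ • A o with hB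
  have hBp : ∀ o, IsProbabilityMeasure (B o) := fun o =>
    ⟨by simp [hB, hAu, ENNReal.inv_mul_cancel ha0 hat]⟩
  have hai : a⁻¹ ≤ 2 := ENNReal.inv_le_iff_inv_le.1 hγC
  have hU : ∀ o o', IsFiniteMeasure (Function.update B o (d o) o') := fun o o' => by
    by_cases ho : o' = o
    · subst ho; rw [Function.update_self]; infer_instance
    · rw [Function.update_of_ne ho]; infer_instance
  -- The measure `κ o` repairs coordinate `o` and adds `t • B o'` to each other coordinate `o'`.
  -- Every coordinate gets `card ι - 1` such extras, all multiples of `A o'`, hence the common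
  -- scalar.
  refine ⟨1 + (Fintype.card ι - 1 : ℕ) * (t * a⁻¹), ν',
    fun o => Measure.pi (Function.update B o (d o)), le_self_add, ?_, hν'ν, ?_, fun o => ⟨?_, ?_⟩⟩
  · exact ENNReal.add_ne_top.2 ⟨ENNReal.one_ne_top, ENNReal.mul_ne_top (ENNReal.natCast_ne_top _)
      (ENNReal.mul_ne_top htt (ENNReal.inv_ne_top.2 ha0))⟩
  · intro o'
    have hsame : (Measure.pi (Function.update B o' (d o'))).map (fun x => x o') = d o' := by
      have e := Measure.pi_map_eval (μ := Function.update B o' (d o')) o'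
      rw [Function.update_self, Finset.prod_eq_one, one_smul] at e
      · exact e
      · intro j hj
        rw [Function.update_of_ne (Finset.ne_of_mem_erase hj)]
        exact measure_univ
    have hother : ∀ o ∈ Finset.univ.erase o',
        (Measure.pi (Function.update B o (d o))).map (fun x => x o') = t • B o' := by
      intro o ho
      have hne : o ≠ o' := Finset.ne_of_mem_erase ho
      have e := Measure.pi_map_eval (μ := Function.update B o (d o)) o'
      rw [Function.update_of_ne hne.symm, Finset.prod_eq_single o, Function.update_self,
        hdu o] at e
      · exact e
      · intro j _ hj
        rw [Function.update_of_ne hj]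
        exact measure_univ
      · intro hn
        exact absurd ho hn
    rw [Measure.map_add _ _ (hev o'), Measure.map_smul, ← Measure.mapₗ_apply_of_measurable (hev o'),
      ← Measure.mapₗ_apply_of_measurable (hev o') (∑ o, _), map_sum]
    simp_rw [Measure.mapₗ_apply_of_measurable (hev o')]
    rw [← Finset.add_sum_erase _ _ (Finset.mem_univ o'), hsame, Finset.sum_congr rfl hother,
      Finset.sum_const, Finset.card_erase_of_mem (Finset.mem_univ o'), Finset.card_univ,
      ← add_assoc, hdA o', add_smul, one_smul, hB,
      ← Nat.cast_smul_eq_nsmul ℝ≥0∞, smul_smul, smul_smul, mul_assoc]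
  · refine le_trans ?_ (pi_smul_measure μ 2).le
    refine pi_mono_measure fun o' => ?_
    have h2 : ∀ ξ : Measure (W o'), ∀ b : ℝ≥0∞, b ≤ 2 → ξ ≤ μ o' → b • ξ ≤ (2 : ℝ≥0) • μ o' := by
      intro ξ b hb hξ
      refine Measure.le_intro fun s _ _ => ?_
      rw [Measure.smul_apply, Measure.smul_apply, ENNReal.smul_def, smul_eq_mul, smul_eq_mul]
      exact mul_le_mul' (by simpa using hb) (hξ s)
    by_cases ho : o' = o
    · subst ho
      rw [Function.update_self]
      simpa using h2 _ 1 one_le_two (hdle o')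
    · rw [Function.update_of_ne ho]
      exact h2 _ _ hai (hAμ o')
  · rw [← Set.pi_univ, Measure.pi_pi, Finset.prod_eq_single o, Function.update_self, hdu]
    · exact htle
    · intro j _ hj
      rw [Function.update_of_ne hj]
      exact measure_univ
    · intro hn
      exact absurd (Finset.mem_univ o) hn

end Competitor

/-! ### Stability of optimal transport -/

section Stability

variable {ι : Type*} [Fintype ι] [Nonempty ι] {W : ι → Type*}

theorem exists_isCompact_monotone_exhaustion {Y : Type*} [TopologicalSpace Y] [PolishSpace Y]
    [MeasurableSpace Y] [BorelSpace Y] (μ : Measure Y) [IsFiniteMeasure μ] :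
    ∃ C : ℕ → Set Y, (∀ k, IsCompact (C k)) ∧ Monotone C ∧ ∀ᵐ y ∂μ, ∃ k, y ∈ C k := by
  let := TopologicalSpace.upgradeIsCompletelyMetrizable Y
  have h := isTightMeasureSet_iff_exists_isCompact_measure_compl_le.1
    (isTightMeasureSet_singleton (μ := μ))
  choose K hK hKμ using fun k : ℕ => h ((k : ℝ≥0∞) + 1)⁻¹ (by simp)
  refine ⟨Set.accumulate K, fun k => ?_, Set.monotone_accumulate, ?_⟩
  · rw [Set.accumulate_def]
    exact (Set.finite_Iic k).isCompact_biUnion fun i _ => hK i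
  · rw [ae_iff]
    have hlim : Tendsto (fun k : ℕ => ((k : ℝ≥0∞) + 1)⁻¹) atTop (𝓝 0) :=
      (ENNReal.tendsto_inv_nat_nhds_zero.comp (tendsto_add_atTop_nat 1)).congr fun k => by simp
    refine le_antisymm (ge_of_tendsto' hlim fun k => ?_) zero_le
    · refine (measure_mono fun y hy => ?_).trans (hKμ k μ rfl)
      intro hyk
      exact hy ⟨k, Set.subset_accumulate hyk⟩

/-- **Stability of optimal transport**: the weak limit of optimal measures of finite cost is
optimal when the cost is integrable for the product of the limiting marginals. -/
theorem isOptimal_of_tendsto [∀ o, TopologicalSpace (W o)] [∀ o, PolishSpace (W o)]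
    [∀ o, MeasurableSpace (W o)] [∀ o, BorelSpace (W o)]
    {c : (∀ o, W o) → ℝ≥0} (hc : Continuous c)
    {τ : Type*} {L : Filter τ} [L.NeBot] {γs : τ → ProbabilityMeasure (∀ o, W o)}
    {γ : ProbabilityMeasure (∀ o, W o)} (hγs : Tendsto γs L (𝓝 γ))
    (hopt : ∀ t, IsOptimal c (γs t : Measure (∀ o, W o)))
    (hfin : ∀ t, ∫⁻ x, c x ∂(γs t : Measure (∀ o, W o)) ≠ ∞)
    {μ : ∀ o, Measure (W o)} [∀ o, IsProbabilityMeasure (μ o)]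
    (hγ : ∀ o, (γ : Measure (∀ o, W o)).map (fun x => x o) = μ o)
    (hint : ∫⁻ x, c x ∂(Measure.pi μ) ≠ ∞) : IsOptimal c (γ : Measure (∀ o, W o)) := by
  let := fun o => TopologicalSpace.upgradeIsCompletelyMetrizable (W o)
  intro ν hνγ
  have hν : ∀ o, ν.map (fun x => x o) = μ o := fun o => (hνγ o).trans (hγ o)
  have : IsProbabilityMeasure ν := ⟨by rw [hνγ.measure_univ_eq]; exact measure_univ⟩
  choose C hC hCm hCμ using fun o => exists_isCompact_monotone_exhaustion (μ o)
  set D : ℕ → Set (∀ o, W o) := fun k => Set.univ.pi fun o => C o k with hD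
  have hDmeas : ∀ k, MeasurableSet (D k) := fun k =>
    MeasurableSet.univ_pi fun o => (hC o k).measurableSet
  have hDm : Monotone D := fun k l hkl => Set.pi_mono fun o _ => hCm o hkl
  have hDu : ∀ᵐ x ∂(γ : Measure (∀ o, W o)), x ∈ ⋃ k, D k := by
    have h1 : ∀ o, ∀ᵐ x ∂(γ : Measure (∀ o, W o)), ∃ k, x o ∈ C o k := fun o => by
      have h2 := hCμ o
      rw [← hγ o] at h2
      exact ae_of_ae_map (measurable_pi_apply o).aemeasurable h2
    filter_upwards [ae_all_iff.2 h1] with x hx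
    choose k hk using hx
    refine Set.mem_iUnion.2 ⟨Finset.univ.sup k, fun o _ => ?_⟩
    exact hCm o (Finset.le_sup (Finset.mem_univ o)) (hk o)
  have hlim : Tendsto (fun k => (γ : Measure (∀ o, W o)) (D k)ᶜ) atTop (𝓝 0) := by
    have h1 := tendsto_measure_iInter_atTop (μ := (γ : Measure (∀ o, W o)))
      (fun k => (hDmeas k).compl.nullMeasurableSet)
      (fun k l hkl => Set.compl_subset_compl.2 (hDm hkl)) ⟨0, measure_ne_top _ _⟩
    rw [← Set.compl_iUnion] at h1
    rwa [show (γ : Measure (∀ o, W o)) (⋃ k, D k)ᶜ = 0 from hDu] at h1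
  have hcost : ∫⁻ x, c x ∂(γ : Measure (∀ o, W o))
      = ⨆ k, ∫⁻ x in D k, c x ∂(γ : Measure (∀ o, W o)) := by
    rw [← setLIntegral_iUnion_of_directed _ (directed_of_isDirected_le hDm),
      Measure.restrict_eq_self_of_ae_mem hDu]
  rw [hcost]
  refine iSup_le fun k => ENNReal.le_of_forall_pos_le_add fun ε hε _ => ?_
  set n := Fintype.card ι with hn
  have hn0 : (n : ℝ≥0∞) ≠ 0 := by simp [hn]
  obtain ⟨δ, hδ, hsmall⟩ := exists_forall_lintegral_le hc.measurable
    (m := (2 : ℝ≥0) ^ n • Measure.pi μ)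
    (by
      rw [lintegral_smul_measure]
      exact ENNReal.mul_ne_top ENNReal.coe_ne_top hint)
    (ε := ε / n) (ENNReal.div_pos (by exact_mod_cast hε.ne') (ENNReal.natCast_ne_top _)).ne'
  -- The bound `2⁻¹` is required by `exists_competitor`; `δ / n` brings the mass of each `κ o` below
  -- `δ`.
  have hpos : (0 : ℝ≥0∞) < min 2⁻¹ (δ / n) :=
    lt_min (by simp) (ENNReal.div_pos hδ (ENNReal.natCast_ne_top _))
  obtain ⟨l, hkl, hl⟩ := ((eventually_ge_atTop k).and (hlim.eventually_lt_const hpos)).exists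
  have hhalf : 2⁻¹ ≤ (γ : Measure (∀ o, W o)) (D l) := by
    have h1 := prob_compl_eq_one_sub (μ := (γ : Measure (∀ o, W o))) (hDmeas l).compl
    rw [compl_compl] at h1
    rw [h1, ← ENNReal.one_sub_inv_two]
    exact tsub_le_tsub_left (hl.le.trans (min_le_left _ _)) _
  obtain ⟨r, ν', κ, hr1, hrt, hν', hsm, hκ⟩ := exists_competitor μ (γ : Measure (∀ o, W o)) ν
    hγ hν (hDmeas l) hhalf
  have : IsFiniteMeasure (r • (γ : Measure (∀ o, W o)).restrict (D l)) :=
    ⟨by simpa using ENNReal.mul_lt_top hrt.lt_top (measure_lt_top _ _)⟩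
  have hmain := lintegral_le_of_tendsto_of_isOptimal hc hγs hopt hfin (fun o => hC o l) hsm
    ((Measure.smul_absolutelyContinuous).trans Measure.restrict_le_self.absolutelyContinuous)
    (Measure.ae_smul_measure
      ((ae_restrict_mem (hDmeas l)).mono fun x hx o => hx o (Set.mem_univ o)) r)
  rw [lintegral_smul_measure, lintegral_add_measure, lintegral_finsetSum_measure] at hmain
  calc ∫⁻ x in D k, c x ∂(γ : Measure (∀ o, W o))
      ≤ ∫⁻ x in D l, c x ∂(γ : Measure (∀ o, W o)) := lintegral_mono_set (hDm hkl)
    _ ≤ r • ∫⁻ x in D l, c x ∂(γ : Measure (∀ o, W o)) := by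
        rw [smul_eq_mul]; exact le_mul_of_one_le_left' hr1
    _ ≤ ∫⁻ x, c x ∂ν' + ∑ o, ∫⁻ x, c x ∂(κ o) := hmain
    _ ≤ ∫⁻ x, c x ∂ν + ∑ _o : ι, (ε / n : ℝ≥0∞) := by
        refine add_le_add (lintegral_mono' hν' le_rfl) (Finset.sum_le_sum fun o _ => ?_)
        refine hsmall _ (hκ o).1 ((hκ o).2.trans ?_)
        refine (mul_le_mul_right (hl.le.trans (min_le_right _ _)) _).trans ?_
        exact ENNReal.mul_div_le
    _ ≤ ∫⁻ x, c x ∂ν + ε := by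
        gcongr
        rw [Finset.sum_const, Finset.card_univ, nsmul_eq_mul]
        exact ENNReal.mul_div_le

end Stability

end MultimarginalOT

namespace OTProjection

/-! ### Convergence of empirical measures -/

section Empirical

variable {Y : Type*} [MeasurableSpace Y]

theorem empiricalMeasure_real_apply (n : ℕ) (x : ℕ → Y) {s : Set Y} (hs : MeasurableSet s) :
    (empiricalMeasure n x).real s = (∑ j ∈ Finset.range n, s.indicator 1 (x j)) / n := by
  have hnn : ∀ j, 0 ≤ s.indicator (1 : Y → ℝ) (x j) := fun j =>
    Set.indicator_nonneg (fun _ _ => zero_le_one) _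
  have h : ∑ j ∈ Finset.range n, s.indicator (1 : Y → ℝ≥0∞) (x j)
      = ENNReal.ofReal (∑ j ∈ Finset.range n, s.indicator 1 (x j)) := by
    rw [ENNReal.ofReal_sum_of_nonneg fun j _ => hnn j]
    refine Finset.sum_congr rfl fun j _ => ?_
    by_cases hj : x j ∈ s <;> simp [hj]
  rw [Measure.real, empiricalMeasure, Measure.smul_apply, Measure.finsetSum_apply, smul_eq_mul]
  simp_rw [Measure.dirac_apply' _ hs]
  rw [h, ENNReal.toReal_mul, ENNReal.toReal_inv, ENNReal.toReal_natCast,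
    ENNReal.toReal_ofReal (Finset.sum_nonneg fun j _ => hnn j), div_eq_inv_mul]

theorem exists_finite_ae_mem_empiricalMeasure [MeasurableSingletonClass Y] (n : ℕ) (x : ℕ → Y) :
    ∃ s : Set Y, s.Finite ∧ ∀ᵐ y ∂(empiricalMeasure n x), y ∈ s := by
  refine ⟨x '' Finset.range n, (Finset.finite_toSet _).image x, ?_⟩
  rw [empiricalMeasure]
  refine Measure.ae_smul_measure ?_ _
  rw [ae_iff, Measure.finsetSum_apply]
  refine Finset.sum_eq_zero fun j hj => ?_
  change Measure.dirac (x j) (x '' Finset.range n)ᶜ = 0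
  rw [Measure.dirac_apply]
  have hmem : x j ∈ x '' Finset.range n := ⟨j, hj, rfl⟩
  exact Set.indicator_of_notMem (Set.notMem_compl_iff.2 hmem) _

theorem ae_tendsto_empiricalMeasure_real {Ω : Type*} [MeasurableSpace Ω] {P : Measure Ω}
    [IsProbabilityMeasure P] {μ : Measure Y} {Z : ℕ → Ω → Y} (hlaw : ∀ j, HasLaw (Z j) μ P)
    (hindep : iIndepFun Z P) {s : Set Y} (hs : MeasurableSet s) :
    ∀ᵐ ω ∂P, Tendsto (fun n => (empiricalMeasure n fun j => Z j ω).real s) atTop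
      (𝓝 (μ.real s)) := by
  have hind : Measurable (s.indicator (1 : Y → ℝ)) := measurable_one.indicator hs
  have hmean : P[fun ω => s.indicator (1 : Y → ℝ) (Z 0 ω)] = μ.real s := by
    rw [← integral_indicator_one hs, ← (hlaw 0).map_eq,
      integral_map (hlaw 0).aemeasurable hind.aestronglyMeasurable]
  have h := strong_law_ae_real (μ := P) (fun j ω => s.indicator (1 : Y → ℝ) (Z j ω)) ?_ ?_ ?_
  · rw [hmean] at h
    filter_upwards [h] with ω hω
    simpa only [empiricalMeasure_real_apply _ _ hs] using hω
  · have : Integrable (s.indicator (1 : Y → ℝ)) (P.map (Z 0)) :=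
      have := Measure.isProbabilityMeasure_map (hlaw 0).aemeasurable
      (integrable_const (1 : ℝ)).indicator hs
    exact this.comp_aemeasurable (hlaw 0).aemeasurable
  · intro i j hij
    exact (hindep.indepFun hij).comp hind hind
  · intro j
    have hid : IdentDistrib (Z j) (Z 0) P P :=
      ⟨(hlaw j).aemeasurable, (hlaw 0).aemeasurable, by rw [(hlaw j).map_eq, (hlaw 0).map_eq]⟩
    exact hid.comp hind

/-- A second countable space has a countable `π`-system of open sets that contains arbitrarily
small neighbourhoods of every point. -/
theorem exists_countable_isPiSystem_isOpen (Y : Type*) [TopologicalSpace Y]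
    [SecondCountableTopology Y] : ∃ S : Set (Set Y), S.Countable ∧ IsPiSystem S ∧
      (∀ s ∈ S, IsOpen s) ∧ ∀ u, IsOpen u → ∀ x ∈ u, ∃ s ∈ S, s ∈ 𝓝 x ∧ s ⊆ u := by
  set b := TopologicalSpace.countableBasis Y
  refine ⟨Set.sInter '' {F | F.Finite ∧ F ⊆ b},
    (Set.countable_ofPred_finite_subset (TopologicalSpace.countable_countableBasis Y)).image _,
    ?_, ?_, fun u hu x hx => ?_⟩
  · rintro _ ⟨F, ⟨hF, hFb⟩, rfl⟩ _ ⟨F', ⟨hF', hFb'⟩, rfl⟩ _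
    exact ⟨F ∪ F', ⟨hF.union hF', Set.union_subset hFb hFb'⟩, Set.sInter_union F F'⟩
  · rintro _ ⟨F, ⟨hF, hFb⟩, rfl⟩
    exact hF.isOpen_sInter fun s hs => TopologicalSpace.isOpen_of_mem_countableBasis (hFb hs)
  · obtain ⟨s, hs, hxs, hsu⟩ :=
      (TopologicalSpace.isBasis_countableBasis Y).exists_subset_of_mem_open hx hu
    exact ⟨s, ⟨{s}, ⟨Set.finite_singleton s, Set.singleton_subset_iff.2 hs⟩,
        Set.sInter_singleton s⟩,
      (TopologicalSpace.isOpen_of_mem_countableBasis hs).mem_nhds hxs, hsu⟩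

/-- **Varadarajan's theorem**: almost surely, the empirical measures of an i.i.d. sequence
converge weakly to its law. -/
theorem ae_tendsto_empiricalMeasure [TopologicalSpace Y] [SecondCountableTopology Y]
    [OpensMeasurableSpace Y] {Ω : Type*} [MeasurableSpace Ω] {P : Measure Ω}
    [IsProbabilityMeasure P] {μ : ProbabilityMeasure Y} {Z : ℕ → Ω → Y}
    (hlaw : ∀ j, HasLaw (Z j) (μ : Measure Y) P) (hindep : iIndepFun Z P) :
    ∀ᵐ ω ∂P, ∀ (n : ℕ → ℕ) (ν : ℕ → ProbabilityMeasure Y), Tendsto n atTop atTop →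
      (∀ t, (ν t : Measure Y) = empiricalMeasure (n t) fun j => Z j ω) →
      Tendsto ν atTop (𝓝 μ) := by
  obtain ⟨S, hSc, hSpi, hSo, hS⟩ := exists_countable_isPiSystem_isOpen Y
  -- The null set of the strong law depends on `s`, so `S` must be countable.
  have h := (ae_ball_iff hSc).2 fun s hs =>
    ae_tendsto_empiricalMeasure_real hlaw hindep (hSo s hs).measurableSet
  filter_upwards [h] with ω hω n ν hn hν
  refine hSpi.tendsto_probabilityMeasure_of_tendsto_of_mem (fun s hs => (hSo s hs).measurableSet)
    hS fun s hs => ?_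
  have h1 := (hω s hs).comp hn
  rw [← NNReal.tendsto_coe]
  refine h1.congr fun t => ?_
  simp only [Function.comp_apply, ← hν t]
  rfl

end Empirical

end OTProjection

namespace MultimarginalOT

open scoped NNReal

/-! ### Tightness from marginals -/

section Compactness

variable {ι : Type*} [Fintype ι] {W : ι → Type*}
  [∀ o, TopologicalSpace (W o)] [∀ o, PolishSpace (W o)]
  [∀ o, MeasurableSpace (W o)] [∀ o, BorelSpace (W o)]

/-- A set of measures on a finite product is tight if all its sets of marginals are. -/
theorem isTightMeasureSet_of_marginals {S : Set (Measure (∀ o, W o))}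
    (h : ∀ o, IsTightMeasureSet ((fun γ => γ.map fun x => x o) '' S)) : IsTightMeasureSet S := by
  rw [isTightMeasureSet_iff_exists_isCompact_measure_compl_le]
  intro ε hε
  have hε' : 0 < ε / Fintype.card ι := ENNReal.div_pos hε.ne' (ENNReal.natCast_ne_top _)
  choose C hC hCS using fun o =>
    isTightMeasureSet_iff_exists_isCompact_measure_compl_le.1 (h o) _ hε'
  refine ⟨Set.univ.pi C, isCompact_univ_pi hC, fun γ hγ => ?_⟩
  have hsub : (Set.univ.pi C)ᶜ ⊆ ⋃ o, (fun x : ∀ o, W o => x o) ⁻¹' (C o)ᶜ := by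
    intro x hx
    simpa [Set.mem_pi] using hx
  calc γ (Set.univ.pi C)ᶜ ≤ ∑ o, γ ((fun x : ∀ o, W o => x o) ⁻¹' (C o)ᶜ) :=
        (measure_mono hsub).trans (measure_iUnion_fintype_le _ _)
    _ ≤ ∑ _o : ι, ε / Fintype.card ι := by
        refine Finset.sum_le_sum fun o _ => ?_
        rw [← Measure.map_apply (measurable_pi_apply o) (hC o).measurableSet.compl]
        exact hCS o _ ⟨γ, hγ, rfl⟩
    _ ≤ ε := by
        rw [Finset.sum_const, Finset.card_univ, nsmul_eq_mul]
        exact ENNReal.mul_div_le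

/-- Measures with weakly convergent marginals have a weakly convergent subsequence. -/
theorem exists_tendsto_subseq_of_marginals {γs : ℕ → ProbabilityMeasure (∀ o, W o)}
    {μs : ∀ o, ℕ → ProbabilityMeasure (W o)} {μ : ∀ o, ProbabilityMeasure (W o)}
    (hγs : ∀ o t, (γs t : Measure (∀ o, W o)).map (fun x => x o) = μs o t)
    (hμ : ∀ o, Tendsto (μs o) atTop (𝓝 (μ o))) :
    ∃ (γ : ProbabilityMeasure (∀ o, W o)) (φ : ℕ → ℕ), StrictMono φ ∧
      Tendsto (γs ∘ φ) atTop (𝓝 γ) ∧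
      ∀ o, (γ : Measure (∀ o, W o)).map (fun x => x o) = μ o := by
  let := fun o => TopologicalSpace.upgradeIsCompletelyMetrizable (W o)
  have htight : IsTightMeasureSet
      {((γ : ProbabilityMeasure (∀ o, W o)) : Measure (∀ o, W o)) | γ ∈ Set.range γs} := by
    refine isTightMeasureSet_of_marginals fun o => ?_
    -- A convergent sequence with its limit is compact; the converse half of Prokhorov's theorem
    -- then gives tightness.
    have hcomp : IsCompact (closure (Set.range (μs o))) :=
      ((hμ o).isCompact_insert_range).closure_of_subset (Set.subset_insert _ _)
    refine (isTightMeasureSet_of_isCompact_closure hcomp).subset ?_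
    rintro _ ⟨_, ⟨_, ⟨t, rfl⟩, rfl⟩, rfl⟩
    exact ⟨μs o t, ⟨t, rfl⟩, (hγs o t).symm⟩
  obtain ⟨γ, -, φ, hφ, hlim⟩ :=
    (isCompact_closure_of_isTightMeasureSet htight).isSeqCompact
      (x := γs) fun t => subset_closure ⟨t, rfl⟩
  refine ⟨γ, φ, hφ, hlim, fun o => ?_⟩
  have h1 := ProbabilityMeasure.tendsto_map_of_tendsto_of_continuous _ _ hlim
    (continuous_apply (A := W) o)
  have h2 : Tendsto (fun k => (γs (φ k)).map (continuous_apply (A := W) o).measurable.aemeasurable)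
      atTop (𝓝 (μ o)) := by
    refine ((hμ o).comp hφ.tendsto_atTop).congr fun k => ?_
    exact Subtype.ext (hγs o (φ k)).symm
  have h3 := congrArg (fun ν : ProbabilityMeasure (W o) => (ν : Measure (W o)))
    (tendsto_nhds_unique h1 h2)
  exact h3

end Compactness

/-! ### Finite cost of discrete problems -/

section FiniteCost

variable {ι : Type*} {W : ι → Type*} [∀ o, TopologicalSpace (W o)] [∀ o, MeasurableSpace (W o)]

/-- A continuous cost has finite integral for measures with finitely supported marginals. -/
theorem lintegral_ne_top_of_finite_marginals [Countable ι]
    {c : (∀ o, W o) → ℝ≥0} (hc : Continuous c)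
    {γ : Measure (∀ o, W o)} [IsFiniteMeasure γ]
    (h : ∀ o, ∃ s : Set (W o), s.Finite ∧ ∀ᵐ y ∂(γ.map fun x => x o), y ∈ s) :
    ∫⁻ x, c x ∂γ ≠ ∞ := by
  choose s hs hγs using h
  obtain ⟨R, hR⟩ := ((isCompact_univ_pi fun o => (hs o).isCompact).bddAbove_image
    hc.continuousOn)
  have hle : ∀ᵐ x ∂γ, (c x : ℝ≥0∞) ≤ R := by
    filter_upwards [ae_all_iff.2 fun o =>
      ae_of_ae_map (measurable_pi_apply o).aemeasurable (hγs o)] with x hx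
    exact_mod_cast hR ⟨x, fun o _ => hx o, rfl⟩
  refine ne_top_of_le_ne_top ?_ (lintegral_mono_ae hle)
  rw [lintegral_const]
  exact ENNReal.mul_ne_top ENNReal.coe_ne_top (measure_ne_top _ _)

end FiniteCost

end MultimarginalOT

/-! ### Projection as a multimarginal problem -/

namespace OTProjection

open scoped NNReal
open MultimarginalOT

universe u

/-- The coordinate spaces `Z, X₁, …, X_K` of the multimarginal problem, where `Z = ∏ X i`. -/
def Coord {K : ℕ} (X : Fin K → Type u) : Option (Fin K) → Type u
  | none => ∀ i, X i
  | some i => X i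

section Coord

variable {K : ℕ} {X : Fin K → Type u}

instance [∀ i, TopologicalSpace (X i)] : ∀ o, TopologicalSpace (Coord X o)
  | none => inferInstanceAs (TopologicalSpace (∀ i, X i))
  | some i => inferInstanceAs (TopologicalSpace (X i))

instance [∀ i, TopologicalSpace (X i)] [∀ i, PolishSpace (X i)] : ∀ o, PolishSpace (Coord X o)
  | none => inferInstanceAs (PolishSpace (∀ i, X i))
  | some i => inferInstanceAs (PolishSpace (X i))

instance [∀ i, MeasurableSpace (X i)] : ∀ o, MeasurableSpace (Coord X o)
  | none => inferInstanceAs (MeasurableSpace (∀ i, X i))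
  | some i => inferInstanceAs (MeasurableSpace (X i))

instance [∀ i, TopologicalSpace (X i)] [∀ i, PolishSpace (X i)] [∀ i, MeasurableSpace (X i)]
    [∀ i, BorelSpace (X i)] : ∀ o, BorelSpace (Coord X o)
  | none => inferInstanceAs (BorelSpace (∀ i, X i))
  | some i => inferInstanceAs (BorelSpace (X i))

/-- The pair `(x, z)` with coordinates `z, x₁, …, x_K`. -/
def toPair (w : ∀ o, Coord X o) : (∀ i, X i) × (∀ i, X i) := (fun i => w (some i), w none)

/-- The coordinates `z, x₁, …, x_K` of the pair `(x, z)`. -/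
def ofPair (p : (∀ i, X i) × (∀ i, X i)) : ∀ o, Coord X o
  | none => p.2
  | some i => p.1 i

theorem continuous_toPair [∀ i, TopologicalSpace (X i)] :
    Continuous (toPair : (∀ o, Coord X o) → _) :=
  (continuous_pi fun i => continuous_apply (A := Coord X) (some i)).prodMk
    (continuous_apply (A := Coord X) none)

section Measurable

variable [∀ i, MeasurableSpace (X i)]

theorem measurable_toPair : Measurable (toPair : (∀ o, Coord X o) → _) :=
  (measurable_pi_lambda _ fun i => measurable_pi_apply (X := Coord X) (some i)).prodMk
    (measurable_pi_apply (X := Coord X) none)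

theorem measurable_ofPair : Measurable (ofPair : _ → ∀ o, Coord X o) := by
  refine measurable_pi_lambda _ fun o => ?_
  cases o with
  | none => exact measurable_snd
  | some i => exact (measurable_pi_apply i).comp measurable_fst

/-- The family of marginals `ρ, ν₁, …, ν_K`. -/
def marginals {K : ℕ} {X : Fin K → Type u} [∀ i, MeasurableSpace (X i)]
    (ν : ∀ i, Measure (X i)) (ρ : Measure (∀ i, X i)) : ∀ o, Measure (Coord X o)
  | none => ρ
  | some i => ν i

/-- The cost function of the multimarginal problem. -/
def multiCost (c : (∀ i, X i) → (∀ i, X i) → ℝ) (w : ∀ o, Coord X o) : ℝ≥0 :=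
  (c (toPair w).1 (toPair w).2).toNNReal

theorem lintegral_multiCost {c : (∀ i, X i) → (∀ i, X i) → ℝ}
    (hc : Measurable (Function.uncurry c)) (g : Measure (∀ o, Coord X o)) :
    ∫⁻ p, ENNReal.ofReal (c p.1 p.2) ∂(g.map toPair) = ∫⁻ w, multiCost c w ∂g := by
  rw [lintegral_map (f := fun p => ENNReal.ofReal (c p.1 p.2)) hc.ennreal_ofReal
    measurable_toPair]
  rfl

theorem lintegral_multiCost_ofPair {c : (∀ i, X i) → (∀ i, X i) → ℝ}
    (hc : Measurable (Function.uncurry c)) (γ : Measure ((∀ i, X i) × (∀ i, X i))) :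
    ∫⁻ w, multiCost c w ∂(γ.map ofPair) = ∫⁻ p, ENNReal.ofReal (c p.1 p.2) ∂γ := by
  rw [← lintegral_multiCost hc, Measure.map_map measurable_toPair measurable_ofPair]
  congr 1
  exact Measure.map_id

/-- A coupling of the marginals `ρ, ν₁, …, ν_K` is a plan to `ρ` from a coupling of
`ν₁, …, ν_K`. -/
theorem exists_plan_of_marginals {ν : ∀ i, Measure (X i)} {ρ : Measure (∀ i, X i)}
    [IsProbabilityMeasure ρ] {g : Measure (∀ o, Coord X o)}
    (hg : ∀ o, g.map (fun w => w o) = marginals ν ρ o) :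
    ∃ π ∈ couplings ν, ∃ γ ∈ plans (π : Measure (∀ i, X i)) ρ,
      (γ : Measure ((∀ i, X i) × (∀ i, X i))) = g.map toPair := by
  have hev : ∀ o, Measurable fun w : ∀ o, Coord X o => w o := fun o => measurable_pi_apply o
  -- The total mass is read off coordinate `none`, which exists even when `K = 0`.
  have hgp : IsProbabilityMeasure g := ⟨by
    have h : g.map (fun w => w none) = ρ := hg none
    have h1 := congrArg (fun m => m Set.univ) h
    rw [Measure.map_apply (hev none) MeasurableSet.univ] at h1
    exact h1.trans measure_univ⟩
  have hp := Measure.isProbabilityMeasure_map (μ := g) measurable_toPair.aemeasurable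
  have hq := Measure.isProbabilityMeasure_map (μ := g.map toPair) measurable_fst.aemeasurable
  refine ⟨⟨(g.map toPair).map Prod.fst, hq⟩, fun i => ?_, ⟨g.map toPair, hp⟩, ⟨rfl, ?_⟩, rfl⟩
  · change ((g.map toPair).map Prod.fst).map (fun x => x i) = ν i
    rw [Measure.map_map (measurable_pi_apply i) measurable_fst,
      Measure.map_map ((measurable_pi_apply i).comp measurable_fst) measurable_toPair]
    exact hg (some i)
  · change (g.map toPair).map Prod.snd = ρ
    rw [Measure.map_map measurable_snd measurable_toPair]
    exact hg none

/-- The converse of `exists_plan_of_marginals`: both problems have the same candidates. -/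
theorem map_ofPair_marginals {ν : ∀ i, Measure (X i)} {ρ : Measure (∀ i, X i)}
    {π : ProbabilityMeasure (∀ i, X i)} (hπ : π ∈ couplings ν)
    {γ : ProbabilityMeasure ((∀ i, X i) × (∀ i, X i))}
    (hγ : γ ∈ plans (π : Measure (∀ i, X i)) ρ) (o : Option (Fin K)) :
    ((γ : Measure ((∀ i, X i) × (∀ i, X i))).map ofPair).map (fun w => w o)
      = marginals ν ρ o := by
  rw [Measure.map_map (measurable_pi_apply o) measurable_ofPair]
  cases o with
  | none => exact hγ.2
  | some i =>
    have h := hπ i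
    rw [← hγ.1, Measure.map_map (measurable_pi_apply i) measurable_fst] at h
    exact h

/-- A projection is the marginal of an optimal measure for the multimarginal problem. -/
theorem IsProjection.exists_isOptimal {c : (∀ i, X i) → (∀ i, X i) → ℝ}
    (hc : Measurable (Function.uncurry c)) {ν : ∀ i, Measure (X i)} {ρ : Measure (∀ i, X i)}
    {π : ProbabilityMeasure (∀ i, X i)} (h : IsProjection c ν ρ π) :
    ∃ g : ProbabilityMeasure (∀ o, Coord X o),
      (∀ o, (g : Measure (∀ o, Coord X o)).map (fun w => w o) = marginals ν ρ o) ∧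
      (g : Measure (∀ o, Coord X o)).map (fun w i => w (some i)) = (π : Measure (∀ i, X i)) ∧
      IsOptimal (multiCost c) (g : Measure (∀ o, Coord X o)) := by
  obtain ⟨hπ, γ, hγ, hmin⟩ := h
  have hρ : IsProbabilityMeasure ρ := by
    rw [← hγ.2]; exact Measure.isProbabilityMeasure_map measurable_snd.aemeasurable
  have hg := map_ofPair_marginals hπ hγ
  refine ⟨ProbabilityMeasure.map γ (f := ofPair) measurable_ofPair.aemeasurable, hg, ?_,
    fun g' hg' => ?_⟩
  · exact (Measure.map_map (measurable_fst.comp measurable_toPair) measurable_ofPair).trans hγ.1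
  · obtain ⟨π', hπ', γ', hγ', hγg⟩ :=
      exists_plan_of_marginals fun o => (hg' o).trans (hg o)
    have := hmin π' hπ' γ' hγ'
    rw [cost, cost, hγg, lintegral_multiCost hc] at this
    exact (lintegral_multiCost_ofPair hc (γ : Measure ((∀ i, X i) × (∀ i, X i)))).le.trans this

/-- The marginal of an optimal measure for the multimarginal problem is a projection. -/
theorem isProjection_of_isOptimal {c : (∀ i, X i) → (∀ i, X i) → ℝ}
    (hc : Measurable (Function.uncurry c)) {ν : ∀ i, Measure (X i)} {ρ : Measure (∀ i, X i)}
    [IsProbabilityMeasure ρ] {g : Measure (∀ o, Coord X o)}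
    (hg : ∀ o, g.map (fun w => w o) = marginals ν ρ o) (hopt : IsOptimal (multiCost c) g)
    {π : ProbabilityMeasure (∀ i, X i)}
    (hπ : g.map (fun w i => w (some i)) = (π : Measure (∀ i, X i))) : IsProjection c ν ρ π := by
  obtain ⟨π₁, hπ₁, γ, hγ, hγg⟩ := exists_plan_of_marginals hg
  have hππ : π₁ = π := by
    refine ProbabilityMeasure.toMeasure_injective ?_
    rw [← hπ, ← hγ.1, hγg, Measure.map_map measurable_fst measurable_toPair]
    rfl
  subst hππ
  refine ⟨hπ₁, γ, hγ, fun π' hπ' γ' hγ' => ?_⟩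
  rw [cost, cost, hγg, lintegral_multiCost hc, ← lintegral_multiCost_ofPair hc]
  exact hopt _ fun o => (map_ofPair_marginals hπ' hγ' o).trans (hg o).symm

/-- Turns integrability under `(⊗ μ) ⊗ π⁰` into the form that `isOptimal_of_tendsto` asks for. -/
theorem pi_marginals (ν : ∀ i, Measure (X i)) (ρ : Measure (∀ i, X i))
    [∀ i, SigmaFinite (ν i)] [SigmaFinite ρ] [∀ o, SigmaFinite (marginals ν ρ o)] :
    Measure.pi (marginals ν ρ) = ((Measure.pi ν).prod ρ).map ofPair := by
  refine (Measure.pi_eq fun s hs => ?_)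
  rw [Measure.map_apply measurable_ofPair (MeasurableSet.univ_pi hs)]
  let sx : ∀ i, Set (X i) := fun i => s (some i)
  let sz : Set (∀ i, X i) := s none
  have : ofPair ⁻¹' Set.univ.pi s = Set.univ.pi sx ×ˢ sz := by
    ext p
    rw [Set.mem_preimage, Set.mem_univ_pi, Option.forall, Set.mem_prod, Set.mem_univ_pi]
    exact and_comm
  rw [this, Measure.prod_prod, Measure.pi_pi, Fintype.prod_option, mul_comm]
  rfl

end Measurable

end Coord

end OTProjection

end

/-! ### Consistency -/

theorem corollaryA3
    {K : ℕ} {X : Fin K → Type*}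
    [∀ i, TopologicalSpace (X i)] [∀ i, PolishSpace (X i)]
    [∀ i, MeasurableSpace (X i)] [∀ i, BorelSpace (X i)]
    -- the marginals and the true coupling `π⁰ ∈ Π(μ)`
    (μ : ∀ i, ProbabilityMeasure (X i)) (π₀ : ProbabilityMeasure (∀ i, X i))
    (hπ₀ : π₀ ∈ OTProjection.couplings (fun i => (μ i : Measure (X i))))
    -- the cost function
    (c : (∀ i, X i) → (∀ i, X i) → ℝ)
    (hc_cont : Continuous (Function.uncurry c))
    (hc_nonneg : ∀ x z, 0 ≤ c x z)
    (hc_diag : ∀ x, c x x = 0)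
    (hc_int : Integrable (Function.uncurry c)
      ((Measure.pi fun i => (μ i : Measure (X i))).prod (π₀ : Measure (∀ i, X i))))
    -- `π⁰` is the only projection of `π⁰` onto `Π(μ)`
    (hc_unique : ∀ π, OTProjection.IsProjection c (fun i => (μ i : Measure (X i)))
      (π₀ : Measure (∀ i, X i)) π → π = π₀)
    -- the coupled data and the marginal data
    {Ω : Type*} [MeasurableSpace Ω] (P : Measure Ω) [IsProbabilityMeasure P]
    (Z : ℕ → Ω → (∀ i, X i))
    (hZ_law : ∀ j, HasLaw (Z j) (π₀ : Measure (∀ i, X i)) P)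
    (hZ_indep : iIndepFun Z P)
    (Y : ∀ i, ℕ → Ω → X i)
    (hY_law : ∀ i j, HasLaw (Y i j) (μ i : Measure (X i)) P)
    (hY_indep : ∀ i, iIndepFun (Y i) P)
    -- the sample sizes
    (m n : ℕ → ℕ) (hm : Tendsto m atTop atTop) (hn : Tendsto n atTop atTop) :
    ∀ᵐ ω ∂P, ∀ πhat : ℕ → ProbabilityMeasure (∀ i, X i),
      (∀ t, OTProjection.IsProjection c
        (fun i => OTProjection.empiricalMeasure (n t) (fun j => Y i j ω))
        (OTProjection.empiricalMeasure (m t) (fun j => Z j ω)) (πhat t)) →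
      ∃ s : ℕ → ℕ, StrictMono s ∧ Tendsto (fun k => πhat (s k)) atTop (𝓝 π₀) := by
  open OTProjection MultimarginalOT in
  have hcm : Measurable (Function.uncurry c) := hc_cont.measurable
  have hcc : Continuous (multiCost c) := continuous_real_toNNReal.comp
    (hc_cont.comp continuous_toPair)
  let M : ∀ o, ProbabilityMeasure (Coord X o) := fun o => match o with
    | none => π₀
    | some i => μ i
  have hM : ∀ o, (M o : Measure (Coord X o))
      = marginals (fun i => (μ i : Measure (X i))) (π₀ : Measure (∀ i, X i)) o := by
    rintro (_ | i) <;> rfl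
  have hprob : ∀ o, IsProbabilityMeasure
      (marginals (fun i => (μ i : Measure (X i))) (π₀ : Measure (∀ i, X i)) o) := fun o => by
    rw [← hM o]; infer_instance
  have hint : ∫⁻ w, multiCost c w ∂(Measure.pi
      (marginals (fun i => (μ i : Measure (X i))) (π₀ : Measure (∀ i, X i)))) ≠ ∞ := by
    rw [pi_marginals, lintegral_multiCost_ofPair hcm]
    exact (lintegral_ofReal_ne_top_iff_integrable hc_cont.aestronglyMeasurable
      (Eventually.of_forall fun p => hc_nonneg p.1 p.2)).2 hc_int
  -- The null set is fixed before `πhat`, so no measurable selection of solutions is involved.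
  filter_upwards [ae_tendsto_empiricalMeasure hZ_law hZ_indep,
    ae_all_iff.2 fun i => ae_tendsto_empiricalMeasure (hY_law i) (hY_indep i)] with ω hZ hY πhat hπ
  choose g hg hgπ hgopt using fun t => (hπ t).exists_isOptimal hcm
  have hconv : ∀ o, Tendsto (fun t => (g t).map (measurable_pi_apply o).aemeasurable) atTop
      (𝓝 (M o)) := by
    rintro (_ | i)
    · exact hZ m _ hm fun t => hg t none
    · exact hY i n _ hn fun t => hg t (some i)
  have hfin : ∀ t, ∫⁻ w, multiCost c w ∂(g t : Measure (∀ o, Coord X o)) ≠ ∞ := fun t => by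
    refine lintegral_ne_top_of_finite_marginals hcc ?_
    rintro (_ | i)
    · rw [hg t none]
      exact exists_finite_ae_mem_empiricalMeasure (Y := ∀ i, X i) _ _
    · rw [hg t (some i)]
      exact exists_finite_ae_mem_empiricalMeasure (Y := X i) _ _
  obtain ⟨γ, φ, hφ, hlim, hγ⟩ := exists_tendsto_subseq_of_marginals (fun o t => rfl) hconv
  have hγ' : ∀ o, (γ : Measure (∀ o, Coord X o)).map (fun w => w o)
      = marginals (fun i => (μ i : Measure (X i))) (π₀ : Measure (∀ i, X i)) o :=
    fun o => (hγ o).trans (hM o)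
  have hopt : IsOptimal (multiCost c) (γ : Measure (∀ o, Coord X o)) :=
    isOptimal_of_tendsto hcc hlim (fun k => hgopt (φ k)) (fun k => hfin (φ k)) hγ' hint
  have hfst : Continuous fun (w : ∀ o, Coord X o) (i : Fin K) => w (some i) :=
    continuous_fst.comp continuous_toPair
  have hproj := hc_unique (γ.map hfst.measurable.aemeasurable)
    (isProjection_of_isOptimal hcm hγ' hopt rfl)
  refine ⟨φ, hφ, ?_⟩
  rw [← hproj]
  refine (ProbabilityMeasure.tendsto_map_of_tendsto_of_continuous _ _ hlim hfst).congr fun k => ?_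
  exact Subtype.ext (hgπ (φ k))
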